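/- Let $\mathcal M$ be a model category which is pointed (its initial and terminal objects coincide, denoted $*$) and satisfies the cube axiom: for every commutative cube in $\mathcal M$ whose bottom face is a homotopy push-out square and whose four vertical faces are homotopy pull-back squares, the top face is a homotopy push-out square. Here a commutative square is a homotopy push-out (resp. homotopy pull-back) if the canonical map from the homotopy push-out of its upper-left span to its last corner (resp. from its first corner to the homotopy pull-back of its lower-right cospan) is a weak equivalence. Let $F_\bullet=(F_1\leftarrow F_0\to F_2)$ and $E_\bullet=(E_1\leftarrow E_0\to E_2)$ be spans in $\mathcal M$, let $B$ be an object, also regarded as the constant span $B=B=B$, and let $j_\bullet:F_\bullet\to E_\bullet$ and $p_\bullet:E_\bullet\to B$ be natural transformations. Let $P$ be an object weakly equivalent to $*$ (via $*\to P$), let $b:P\to B$ be a map, and let $c_\bullet:F_\bullet\to P$ be a natural transformation to the constant span. Assume that for $i=0,1,2$ the object $F_i$ is the homotopy fiber of $p_i$, in the sense that the square $$\begin{array}{ccc}F_i&\xrightarrow{\;j_i\;}&E_i\\ {\scriptstyle c_i}\downarrow&&\downarrow{\scriptstyle p_i}\\ P&\xrightarrow{\;b\;}&B\end{array}$$ commutes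 and is a homotopy pull-back. (For $P=*$ this says that $p_ij_i$ is trivial and $F_i$ is the homotopy pull-back of $*\to B\leftarrow E_i$.) Let $F=\operatorname{hocolim}F_\bullet$ and $E=\operatorname{hocolim}E_\bullet$, computed as the colimits of any cofibrant replacements $\tilde F_\bullet\to F_\bullet$ and $\tilde E_\bullet\to E_\bullet$ (objectwise weak equivalences from spans whose middle object is cofibrant and whose two legs are cofibrations) such that $j_\bullet$ lifts to a natural transformation $\tilde\jmath_\bullet:\tilde F_\bullet\to\tilde E_\bullet$; let $j:F\to E$, $p:E\to B$ and $c:F\to P$ be the induced maps. Then $F$ is the homotopy fiber of $p$: the square $$\begin{array}{ccc}F&\xrightarrow{\;j\;}&E\\ {\scriptstyle c}\downarrow&&\downarrow{\scriptstyle p}\\ P&\xrightarrow{\;b\;}&B\end{array}$$ commutes and is a homotopy pull-back. -/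

import Mathlib

open CategoryTheory CategoryTheory.Limits HomotopicalAlgebra

universe v u

namespace HoFiber

variable {M : Type u} [Category.{v} M] [ModelCategory M]

/-- A span `Q₁ ← Q₀ → Q₂` is cofibrant (in the projective model structure on spans) if `Q₀` is a
cofibrant object and both legs are cofibrations. -/
structure IsCofibrantSpan (Q : WalkingSpan ⥤ M) : Prop where
  cofibrant_zero : IsCofibrant (Q.obj WalkingSpan.zero)
  cofibration_fst : Cofibration (Q.map WalkingSpan.Hom.fst)
  cofibration_snd : Cofibration (Q.map WalkingSpan.Hom.snd)

/-- A cospan `R₁ → R₀ ← R₂` is fibrant (in the injective model structure on cospans) if `R₀` is a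
fibrant object and both legs are fibrations. -/
structure IsFibrantCospan (R : WalkingCospan ⥤ M) : Prop where
  fibrant_one : IsFibrant (R.obj WalkingCospan.one)
  fibration_inl : Fibration (R.map WalkingCospan.Hom.inl)
  fibration_inr : Fibration (R.map WalkingCospan.Hom.inr)

/-- A cofibrant replacement of a span `X`: a cofibrant span with an objectwise weak equivalence
to `X`. -/
structure CofibrantReplacement (X : WalkingSpan ⥤ M) where
  /-- the cofibrant span -/
  diag : WalkingSpan ⥤ M
  /-- the augmentation -/
  π : diag ⟶ X
  isCofibrantSpan : IsCofibrantSpan diag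
  weakEquivalence : ∀ i, WeakEquivalence (π.app i)

/-- A fibrant replacement of a cospan `X`: a fibrant cospan with an objectwise weak equivalence
from `X`. -/
structure FibrantReplacement (X : WalkingCospan ⥤ M) where
  /-- the fibrant cospan -/
  diag : WalkingCospan ⥤ M
  /-- the coaugmentation -/
  ι : X ⟶ diag
  isFibrantCospan : IsFibrantCospan diag
  weakEquivalence : ∀ i, WeakEquivalence (ι.app i)

namespace CofibrantReplacement

variable {X Y : WalkingSpan ⥤ M}

/-- The homotopy colimit (homotopy push-out) of the span `X`, computed as the colimit of a
cofibrant replacement. -/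
noncomputable abbrev hocolim (Q : CofibrantReplacement X) : M := colimit Q.diag

/-- The map `hocolim X ⟶ T` induced by a natural transformation from `X` to the constant span
at `T`. -/
noncomputable def desc (Q : CofibrantReplacement X) {T : M}
    (t : X ⟶ (Functor.const WalkingSpan).obj T) : Q.hocolim ⟶ T :=
  colimit.desc Q.diag ⟨T, Q.π ≫ t⟩

/-- The map `hocolim X ⟶ hocolim Y` induced by a morphism between the cofibrant replacements. -/
noncomputable def map (Q : CofibrantReplacement X) (R : CofibrantReplacement Y)
    (f : Q.diag ⟶ R.diag) : Q.hocolim ⟶ R.hocolim :=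
  colimMap f

end CofibrantReplacement

namespace FibrantReplacement

variable {X : WalkingCospan ⥤ M}

/-- The homotopy limit (homotopy pull-back) of the cospan `X`, computed as the limit of a
fibrant replacement. -/
noncomputable abbrev holim (R : FibrantReplacement X) : M := limit R.diag

/-- The map `T ⟶ holim X` induced by a natural transformation from the constant cospan at `T`
to `X`. -/
noncomputable def lift (R : FibrantReplacement X) {T : M}
    (t : (Functor.const WalkingCospan).obj T ⟶ X) : T ⟶ R.holim :=
  limit.lift R.diag ⟨T, t ≫ R.ι⟩

end FibrantReplacement

/-- The square with top `f : A ⟶ X`, left `g : A ⟶ Y`, right `h : X ⟶ D`, bottom `k : Y ⟶ D`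
is a homotopy push-out: it commutes, and the canonical map from the homotopy push-out of
`X ← A → Y` to `D` is a weak equivalence. -/
def IsHomotopyPushout {A X Y D : M} (f : A ⟶ X) (g : A ⟶ Y) (h : X ⟶ D) (k : Y ⟶ D) : Prop :=
  ∃ (w : f ≫ h = g ≫ k) (Q : CofibrantReplacement (span f g)),
    WeakEquivalence (Q.desc (PushoutCocone.mk h k w).ι)

/-- The square with top `f : A ⟶ X`, left `g : A ⟶ Y`, right `h : X ⟶ D`, bottom `k : Y ⟶ D`
is a homotopy pull-back: it commutes, and the canonical map from `A` to the homotopy pull-back of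
`X → D ← Y` is a weak equivalence. -/
def IsHomotopyPullback {A X Y D : M} (f : A ⟶ X) (g : A ⟶ Y) (h : X ⟶ D) (k : Y ⟶ D) : Prop :=
  ∃ (w : f ≫ h = g ≫ k) (R : FibrantReplacement (cospan h k)),
    WeakEquivalence (R.lift (PullbackCone.mk f g w).π)

variable (M) in
/-- The cube axiom: in every commutative cube (top face `A'`, bottom face `A`, vertical maps
`aᵢ : A'ᵢ ⟶ Aᵢ`) whose bottom face is a homotopy push-out square and whose four vertical faces are
homotopy pull-back squares, the top face is a homotopy push-out square. -/
def CubeAxiom : Prop :=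
  ∀ {A₀ A₁ A₂ A₃ A'₀ A'₁ A'₂ A'₃ : M}
    (f : A₀ ⟶ A₁) (g : A₀ ⟶ A₂) (h : A₁ ⟶ A₃) (k : A₂ ⟶ A₃)
    (f' : A'₀ ⟶ A'₁) (g' : A'₀ ⟶ A'₂) (h' : A'₁ ⟶ A'₃) (k' : A'₂ ⟶ A'₃)
    (a₀ : A'₀ ⟶ A₀) (a₁ : A'₁ ⟶ A₁) (a₂ : A'₂ ⟶ A₂) (a₃ : A'₃ ⟶ A₃),
    f' ≫ h' = g' ≫ k' →
    IsHomotopyPushout f g h k →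
    IsHomotopyPullback f' a₀ a₁ f →
    IsHomotopyPullback g' a₀ a₂ g →
    IsHomotopyPullback h' a₁ a₃ h →
    IsHomotopyPullback k' a₂ a₃ k →
    IsHomotopyPushout f' g' h' k'

/-- In a pointed model category, `j : F ⟶ E` is the homotopy fibre of `p : E ⟶ B`, as witnessed by
the commutative square with left side `c : F ⟶ P` and bottom `b : P ⟶ B`: the object `P` is weakly
equivalent to the zero object `*` and the square is a homotopy pull-back. For `P = *` this
says that `F` is the homotopy pull-back of `* → B ← E`; for other `P` it is the same up to
replacing `* → B` by the weakly equivalent map `P → B` (such as a path fibration). -/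
def IsHomotopyFiber [HasZeroObject M] {F E B P : M}
    (j : F ⟶ E) (p : E ⟶ B) (c : F ⟶ P) (b : P ⟶ B) : Prop :=
  WeakEquivalence ((isZero_zero M).to_ P) ∧ IsHomotopyPullback j c p b

end HoFiber

/-! Pull the homotopy push-out of `E` back along `P → B`. Replace `hocolim E → B ← P` by a fibrant
cospan and let `T` be its strict pull-back. The claim is that `hocolim F → T` is a weak equivalence.
Consider the cube with top `F̃₀, F̃₁, F̃₂, T` over bottom `Ẽ₀, Ẽ₁, Ẽ₂` and the replaced `hocolim E`.
The bottom is a homotopy push-out; by pasting and cancellation over `P → B`, every vertical face is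
a homotopy pull-back. The cube axiom makes the top a homotopy push-out, and as `F̃` is cofibrant
this is the claim.

What remains is the calculus of homotopy pull-backs: independence of the fibrant replacement
(`weakEquivalence_lift_iff`) and the pasting law (`paste_horiz_iff`). Independence rests on the
gluing lemma, proved without properness because the cospans involved are fibrant. -/

namespace HoFiber

section

variable {C : Type u} [Category.{v} C] [ModelCategory C]

/-! ### Base change of weak equivalences and the gluing lemma -/

lemma exists_isPullback {X Y D : C} (f : X ⟶ D) (g : Y ⟶ D) :
    ∃ (T : C) (a : T ⟶ X) (b : T ⟶ Y), IsPullback a b f g :=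
  ⟨_, _, _, IsPullback.of_hasPullback f g⟩

lemma fibration_of_isPullback {A X Y D : C} {a : A ⟶ X} {b : A ⟶ Y} {f : X ⟶ D} {g : Y ⟶ D}
    (h : IsPullback a b f g) [hf : Fibration f] : Fibration b := by
  rw [fibration_iff] at hf ⊢
  exact MorphismProperty.of_isPullback h hf

lemma weakEquivalence_of_isPullback_of_fibration {A X Y D : C} {a : A ⟶ X} {b : A ⟶ Y}
    {f : X ⟶ D} {g : Y ⟶ D} (h : IsPullback a b f g) [Fibration f] [WeakEquivalence f] :
    WeakEquivalence b :=
  ((mem_trivialFibrations_iff b).1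
    (MorphismProperty.of_isPullback (P := trivialFibrations C) h
      (mem_trivialFibrations f))).2

lemma weakEquivalence_of_fibration_between_fibrations {B B' X X' A A' : C}
    {e : X ⟶ B} {e' : X' ⟶ B} {w : X ⟶ X'} (hw : w ≫ e' = e) {g : B' ⟶ B}
    {a₁ : A ⟶ X} {a₂ : A ⟶ B'} {a₁' : A' ⟶ X'} {a₂' : A' ⟶ B'}
    (h : IsPullback a₁ a₂ e g) (h' : IsPullback a₁' a₂' e' g)
    {t : A ⟶ A'} (h₁ : t ≫ a₁' = a₁ ≫ w) (h₂ : t ≫ a₂' = a₂)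
    [Fibration w] [WeakEquivalence w] : WeakEquivalence t := by
  subst hw h₂
  exact weakEquivalence_of_isPullback_of_fibration
    (IsPullback.of_bot (by simpa using h) h₁.symm h')

/-- Base change along an arbitrary map preserves weak equivalences between fibrations. -/
lemma weakEquivalence_baseChange {B B' X X' A A' : C}
    {e : X ⟶ B} {e' : X' ⟶ B} [Fibration e] [Fibration e'] {w : X ⟶ X'} [WeakEquivalence w]
    (hw : w ≫ e' = e) {g : B' ⟶ B}
    {a₁ : A ⟶ X} {a₂ : A ⟶ B'} {a₁' : A' ⟶ X'} {a₂' : A' ⟶ B'}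
    (h : IsPullback a₁ a₂ e g) (h' : IsPullback a₁' a₂' e' g)
    {t : A ⟶ A'} (h₁ : t ≫ a₁' = a₁ ≫ w) (h₂ : t ≫ a₂' = a₂) : WeakEquivalence t := by
  obtain ⟨W, p₁, p₂, hW⟩ := exists_isPullback e e'
  have : Fibration p₁ := fibration_of_isPullback hW.flip
  have : Fibration p₂ := fibration_of_isPullback hW
  let l : X ⟶ W := hW.lift (𝟙 X) w (by simp [hw])
  -- Ken Brown's trick over `B`: factoring the graph of `w` gives a span of trivial fibrations `q₁`,
  -- `q₂` over `B`, and these survive base change along `g`.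
  let d := MorphismProperty.factorizationData (trivialCofibrations C) (fibrations C) l
  let q₁ : d.Z ⟶ X := d.p ≫ p₁
  let q₂ : d.Z ⟶ X' := d.p ≫ p₂
  have s₁ : d.i ≫ q₁ = 𝟙 X := by simp [q₁, l]
  have s₂ : d.i ≫ q₂ = w := by simp [q₂, l]
  have hq : q₂ ≫ e' = q₁ ≫ e := by simp [q₁, q₂, hW.w]
  have : Fibration q₁ := inferInstanceAs (Fibration (d.p ≫ _))
  have : Fibration q₂ := inferInstanceAs (Fibration (d.p ≫ _))
  have : WeakEquivalence q₁ := weakEquivalence_of_precomp_of_fac s₁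
  have : WeakEquivalence q₂ := weakEquivalence_of_precomp_of_fac s₂
  obtain ⟨Z, z₁, z₂, hZ⟩ := exists_isPullback (q₁ ≫ e) g
  let v₁ : Z ⟶ A := h.lift (z₁ ≫ q₁) z₂ (by simpa using hZ.w)
  let v₂ : Z ⟶ A' := h'.lift (z₁ ≫ q₂) z₂ (by simpa [hq] using hZ.w)
  have : WeakEquivalence v₁ := weakEquivalence_of_fibration_between_fibrations
    (w := q₁) rfl hZ h (by simp [v₁]) (by simp [v₁])
  have : WeakEquivalence v₂ := weakEquivalence_of_fibration_between_fibrations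
    (w := q₂) hq hZ h' (by simp [v₂]) (by simp [v₂])
  let s : A ⟶ Z := hZ.lift (a₁ ≫ d.i) a₂ (by rw [Category.assoc, reassoc_of% s₁, h.w])
  have hs₁ : s ≫ v₁ = 𝟙 A := h.hom_ext (by simp [s, v₁, s₁]) (by simp [s, v₁])
  have hs₂ : s ≫ v₂ = t := h'.hom_ext (by simp [s, v₂, s₂, h₁]) (by simp [s, v₂, h₂])
  have : WeakEquivalence s := weakEquivalence_of_postcomp_of_fac hs₁
  rw [← hs₂]
  infer_instance

/-- View `(e, 𝟙) : X ⟶ Z ×_Y X` as a map of fibrations over `Z`. It is a weak equivalence, being a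
section of the base change of `r`. Restricted along `i`, its target becomes `Y ×_Y X = X` and the
map becomes `a`. -/
lemma weakEquivalence_of_isPullback_of_retraction {X Y Z A : C} {e : X ⟶ Z} [Fibration e]
    {i : Y ⟶ Z} {r : Z ⟶ Y} [Fibration r] [WeakEquivalence r] (hr : i ≫ r = 𝟙 Y)
    {a : A ⟶ X} {b : A ⟶ Y} (h : IsPullback a b e i) : WeakEquivalence a := by
  obtain ⟨W, p₁, p₂, hW⟩ := exists_isPullback r (e ≫ r)
  have : Fibration p₁ := fibration_of_isPullback hW.flip
  have : WeakEquivalence p₂ := weakEquivalence_of_isPullback_of_fibration hW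
  let w : X ⟶ W := hW.lift e (𝟙 X) (by simp)
  let l : X ⟶ W := hW.lift (e ≫ r ≫ i) (𝟙 X) (by simp [hr])
  have : WeakEquivalence w :=
    weakEquivalence_of_postcomp_of_fac (g := p₂) (fg := 𝟙 X) (by simp [w])
  have hl : IsPullback l (e ≫ r) p₁ i := by
    refine IsPullback.of_right (h₁₂ := p₂) (h₂₂ := r) (v₁₃ := e ≫ r) ?_ (by simp [l]) hW.flip
    have : l ≫ p₂ = 𝟙 X := by simp [l]
    rw [this, hr]
    exact IsPullback.of_horiz_isIso ⟨by simp⟩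
  refine weakEquivalence_baseChange (w := w) (by simp [w]) h hl ?_ ?_
  · apply hW.hom_ext
    · simp [l, w, h.w_assoc, reassoc_of% hr, h.w]
    · simp [l, w]
  · rw [h.w_assoc, hr, Category.comp_id]

/-- The base change of a weak equivalence between fibrant objects along a fibration
is a weak equivalence. -/
lemma weakEquivalence_of_isPullback_of_isFibrant {X Y D A : C} {a : A ⟶ X} {b : A ⟶ Y}
    {f : X ⟶ D} {g : Y ⟶ D} (h : IsPullback a b f g) [Fibration f] [WeakEquivalence g]
    [IsFibrant Y] [IsFibrant D] : WeakEquivalence a := by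
  obtain ⟨d⟩ : Nonempty (FibrantBrownFactorization g) := inferInstance
  obtain ⟨Z, p₁, p₂, hZ⟩ := exists_isPullback f d.p
  have : Fibration p₂ := fibration_of_isPullback hZ
  have : WeakEquivalence p₁ := weakEquivalence_of_isPullback_of_fibration hZ.flip
  let l : A ⟶ Z := hZ.lift a (b ≫ d.i) (by simp [h.w])
  have hl : l ≫ p₁ = a := by simp [l]
  have : WeakEquivalence l := by
    refine weakEquivalence_of_isPullback_of_retraction (b := b) (e := p₂) d.i_r
      (IsPullback.of_right (h₁₂ := p₁) (h₂₂ := d.p) ?_ (by simp [l]) hZ)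
    rwa [hl, d.fac]
  rw [← hl]
  infer_instance

/-- The gluing lemma: a pointwise weak equivalence between fibrant cospans induces a weak
equivalence on pull-backs. -/
lemma weakEquivalence_of_isPullback_of_isPullback {A X Y D A' X' Y' D' : C}
    {a : A ⟶ X} {b : A ⟶ Y} {f : X ⟶ D} {g : Y ⟶ D}
    {a' : A' ⟶ X'} {b' : A' ⟶ Y'} {f' : X' ⟶ D'} {g' : Y' ⟶ D'}
    (h : IsPullback a b f g) (h' : IsPullback a' b' f' g')
    {t : A ⟶ A'} {x : X ⟶ X'} {y : Y ⟶ Y'} {d : D ⟶ D'}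
    (ha : t ≫ a' = a ≫ x) (hb : t ≫ b' = b ≫ y) (hf : x ≫ f' = f ≫ d) (hg : y ≫ g' = g ≫ d)
    [Fibration f] [Fibration g] [Fibration f'] [Fibration g'] [IsFibrant D] [IsFibrant D']
    [WeakEquivalence x] [WeakEquivalence y] [WeakEquivalence d] : WeakEquivalence t := by
  have : IsFibrant Y := isFibrant_of_fibration g
  have : IsFibrant Y' := isFibrant_of_fibration g'
  obtain ⟨Z, p₁, p₂, hZ⟩ := exists_isPullback f' d
  have : Fibration p₂ := fibration_of_isPullback hZ
  obtain ⟨T, t₁, t₂, hT⟩ := exists_isPullback p₂ g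
  let l : X ⟶ Z := hZ.lift x f hf
  have hl₁ : l ≫ p₁ = x := by simp [l]
  have hl₂ : l ≫ p₂ = f := by simp [l]
  have : WeakEquivalence p₁ := weakEquivalence_of_isPullback_of_isFibrant hZ
  have : WeakEquivalence l := weakEquivalence_of_postcomp_of_fac hl₁
  let s : A ⟶ T := hT.lift (a ≫ l) b (by simp [hl₂, h.w])
  have : WeakEquivalence s :=
    weakEquivalence_baseChange hl₂ h hT (by simp [s]) (by simp [s])
  let r : T ⟶ A' := h'.lift (t₁ ≫ p₁) (t₂ ≫ y) (by simp [hZ.w, hT.w_assoc, hg])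
  have : Fibration b' := fibration_of_isPullback h'
  have : WeakEquivalence r := by
    have hr : r ≫ a' = t₁ ≫ p₁ := by simp [r]
    refine weakEquivalence_of_isPullback_of_isFibrant (f := b') (g := y) (b := t₂)
      (IsPullback.of_right (h₁₂ := a') (h₂₂ := g') ?_ (by simp [r]) h')
    rw [hr, hg]
    exact hT.paste_horiz hZ
  have : s ≫ r = t := h'.hom_ext (by simp [s, r, hl₁, ha]) (by simp [s, r, hb])
  rw [← this]
  infer_instance

lemma isFibrant_op (A : C) [IsCofibrant A] : IsFibrant (Opposite.op A) :=
  (isFibrant_iff_of_isTerminal (initial.to A).op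
    (terminalOpOfInitial initialIsInitial)).2 inferInstance

/-- The gluing lemma for push-outs of cofibrant spans. -/
lemma weakEquivalence_of_isPushout_of_isPushout {A X Y D A' X' Y' D' : C}
    {f : A ⟶ X} {g : A ⟶ Y} {h : X ⟶ D} {k : Y ⟶ D}
    {f' : A' ⟶ X'} {g' : A' ⟶ Y'} {h' : X' ⟶ D'} {k' : Y' ⟶ D'}
    (sq : IsPushout f g h k) (sq' : IsPushout f' g' h' k')
    {a : A ⟶ A'} {x : X ⟶ X'} {y : Y ⟶ Y'} {t : D ⟶ D'}
    (hf : f ≫ x = a ≫ f') (hg : g ≫ y = a ≫ g') (hh : h ≫ t = x ≫ h') (hk : k ≫ t = y ≫ k')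
    [Cofibration f] [Cofibration g] [Cofibration f'] [Cofibration g']
    [IsCofibrant A] [IsCofibrant A']
    [WeakEquivalence a] [WeakEquivalence x] [WeakEquivalence y] : WeakEquivalence t := by
  rw [← weakEquivalences_op_iff]
  have : IsFibrant (Opposite.op A) := isFibrant_op A
  have : IsFibrant (Opposite.op A') := isFibrant_op A'
  exact weakEquivalence_of_isPullback_of_isPullback sq'.op sq.op
    (x := y.op) (y := x.op) (d := a.op)
    (by simp only [← op_comp, hk]) (by simp only [← op_comp, hh])
    (by simp only [← op_comp, hg]) (by simp only [← op_comp, hf])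

/-! ### Independence of the fibrant replacement -/

/-- A fibrant replacement of the cospan `X → D ← Y`, together with a pull-back of the
replacement. -/
structure PullbackModel {X Y D : C} (h : X ⟶ D) (k : Y ⟶ D) where
  (X' Y' D' T : C)
  x : X ⟶ X'
  y : Y ⟶ Y'
  d : D ⟶ D'
  h' : X' ⟶ D'
  k' : Y' ⟶ D'
  fst : T ⟶ X'
  snd : T ⟶ Y'
  isPullback : IsPullback fst snd h' k'
  comm_left : x ≫ h' = h ≫ d
  comm_right : y ≫ k' = k ≫ d
  [isFibrant : IsFibrant D']
  [fibration_left : Fibration h']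
  [fibration_right : Fibration k']
  [weakEquivalence_x : WeakEquivalence x]
  [weakEquivalence_y : WeakEquivalence y]
  [weakEquivalence_d : WeakEquivalence d]

namespace PullbackModel

attribute [instance] isFibrant fibration_left fibration_right weakEquivalence_x
  weakEquivalence_y weakEquivalence_d

variable {A X Y D : C} {f : A ⟶ X} {g : A ⟶ Y} {h : X ⟶ D} {k : Y ⟶ D}

/-- The map to the pull-back of the replacement induced by a commutative square. -/
noncomputable def lift (R : PullbackModel h k) (w : f ≫ h = g ≫ k) : A ⟶ R.T :=
  R.isPullback.lift (f ≫ R.x) (g ≫ R.y) (by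
    rw [Category.assoc, Category.assoc, R.comm_left, R.comm_right, reassoc_of% w])

@[simp] lemma lift_fst (R : PullbackModel h k) (w : f ≫ h = g ≫ k) :
    R.lift w ≫ R.fst = f ≫ R.x := R.isPullback.lift_fst _ _ _

@[simp] lemma lift_snd (R : PullbackModel h k) (w : f ≫ h = g ≫ k) :
    R.lift w ≫ R.snd = g ≫ R.y := R.isPullback.lift_snd _ _ _

lemma lift_eq (R : PullbackModel h k) (w : f ≫ h = g ≫ k) {t : A ⟶ R.T}
    (h₁ : t ≫ R.fst = f ≫ R.x) (h₂ : t ≫ R.snd = g ≫ R.y) : R.lift w = t :=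
  R.isPullback.hom_ext (by simp [h₁]) (by simp [h₂])

/-- A replacement into which the original cospan maps by objectwise cofibrations. -/
lemma exists_cofibration (h : X ⟶ D) (k : Y ⟶ D) :
    ∃ S : PullbackModel h k, Cofibration S.x ∧ Cofibration S.y ∧ Cofibration S.d := by
  let d := MorphismProperty.factorizationData (trivialCofibrations C) (fibrations C)
    (terminal.from D)
  let x := MorphismProperty.factorizationData (trivialCofibrations C) (fibrations C) (h ≫ d.i)
  let y := MorphismProperty.factorizationData (trivialCofibrations C) (fibrations C) (k ≫ d.i)
  have : IsFibrant d.Z := by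
    rw [isFibrant_iff, Subsingleton.elim (terminal.from d.Z) d.p]
    infer_instance
  obtain ⟨T, a, b, hT⟩ := exists_isPullback x.p y.p
  exact ⟨⟨_, _, _, _, x.i, y.i, d.i, x.p, y.p, a, b, hT, x.fac, y.fac⟩,
    inferInstance, inferInstance, inferInstance⟩

/-- The maps into `S` are trivial cofibrations, so those into `R` extend over them: first on the
corner, then on the legs against the fibrations of `R`. The gluing lemma applies to the resulting
map of fibrant cospans. -/
lemma weakEquivalence_lift_iff_of_cofibration (S R : PullbackModel h k)
    [Cofibration S.x] [Cofibration S.y] [Cofibration S.d] (w : f ≫ h = g ≫ k) :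
    WeakEquivalence (S.lift w) ↔ WeakEquivalence (R.lift w) := by
  have sd : CommSq R.d S.d (terminal.from R.D') (terminal.from S.D') :=
    ⟨Subsingleton.elim _ _⟩
  have : WeakEquivalence sd.lift := weakEquivalence_of_precomp_of_fac sd.fac_left
  have sx : CommSq R.x S.x R.h' (S.h' ≫ sd.lift) :=
    ⟨by rw [R.comm_left, reassoc_of% S.comm_left, sd.fac_left]⟩
  have : WeakEquivalence sx.lift := weakEquivalence_of_precomp_of_fac sx.fac_left
  have sy : CommSq R.y S.y R.k' (S.k' ≫ sd.lift) :=
    ⟨by rw [R.comm_right, reassoc_of% S.comm_right, sd.fac_left]⟩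
  have : WeakEquivalence sy.lift := weakEquivalence_of_precomp_of_fac sy.fac_left
  let t : S.T ⟶ R.T := R.isPullback.lift (S.fst ≫ sx.lift) (S.snd ≫ sy.lift) (by
    rw [Category.assoc, Category.assoc, sx.fac_right, sy.fac_right, S.isPullback.w_assoc])
  have : WeakEquivalence t := weakEquivalence_of_isPullback_of_isPullback
    S.isPullback R.isPullback (R.isPullback.lift_fst _ _ _) (R.isPullback.lift_snd _ _ _)
    sx.fac_right sy.fac_right
  have ht : R.lift w = S.lift w ≫ t := R.lift_eq w
    (by rw [Category.assoc, R.isPullback.lift_fst, ← Category.assoc, S.lift_fst, Category.assoc,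
      sx.fac_left])
    (by rw [Category.assoc, R.isPullback.lift_snd, ← Category.assoc, S.lift_snd, Category.assoc,
      sy.fac_left])
  rw [ht, weakEquivalence_postcomp_iff]

lemma weakEquivalence_lift_iff (R R' : PullbackModel h k) (w : f ≫ h = g ≫ k) :
    WeakEquivalence (R.lift w) ↔ WeakEquivalence (R'.lift w) := by
  obtain ⟨S, _, _, _⟩ := exists_cofibration h k
  rw [← S.weakEquivalence_lift_iff_of_cofibration R, S.weakEquivalence_lift_iff_of_cofibration R']

/-- The model given by the limit of a fibrant replacement. -/
noncomputable def ofFibrantReplacement (R : FibrantReplacement (cospan h k)) :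
    PullbackModel h k :=
  have := R.isFibrantCospan.fibrant_one
  have := R.isFibrantCospan.fibration_inl
  have := R.isFibrantCospan.fibration_inr
  { X' := R.diag.obj .left
    Y' := R.diag.obj .right
    D' := R.diag.obj .one
    T := R.holim
    x := R.ι.app .left
    y := R.ι.app .right
    d := R.ι.app .one
    h' := R.diag.map WalkingCospan.Hom.inl
    k' := R.diag.map WalkingCospan.Hom.inr
    fst := limit.π R.diag .left
    snd := limit.π R.diag .right
    isPullback := IsPullback.of_isLimit_cone (limit.isLimit R.diag)
    comm_left := (R.ι.naturality WalkingCospan.Hom.inl).symm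
    comm_right := (R.ι.naturality WalkingCospan.Hom.inr).symm
    weakEquivalence_x := R.weakEquivalence _
    weakEquivalence_y := R.weakEquivalence _
    weakEquivalence_d := R.weakEquivalence _ }

lemma weakEquivalence_ofFibrantReplacement_lift_iff (R : FibrantReplacement (cospan h k))
    (w : f ≫ h = g ≫ k) :
    WeakEquivalence ((ofFibrantReplacement R).lift w) ↔
      WeakEquivalence (R.lift (PullbackCone.mk f g w).π) := by
  have : (ofFibrantReplacement R).lift w = R.lift (PullbackCone.mk f g w).π :=
    lift_eq _ _ (limit.lift_π _ _) (limit.lift_π _ _)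
  rw [this]
  rfl

/-- The fibrant replacement underlying a model. -/
noncomputable def toFibrantReplacement (R : PullbackModel h k) :
    FibrantReplacement (cospan h k) where
  diag := cospan R.h' R.k'
  ι :=
    { app := fun i => match i with
        | .left => R.x
        | .right => R.y
        | .one => R.d
      naturality := by
        rintro _ _ (_ | _ | _)
        · dsimp; simp
        · exact R.comm_left.symm
        · exact R.comm_right.symm }
  isFibrantCospan := ⟨R.isFibrant, R.fibration_left, R.fibration_right⟩
  weakEquivalence := by
    rintro (_ | _ | _)
    exacts [R.weakEquivalence_d, R.weakEquivalence_x, R.weakEquivalence_y]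

end PullbackModel

/-! ### Calculus of homotopy pull-back squares -/

section

variable {A X Y D : C} {f : A ⟶ X} {g : A ⟶ Y} {h : X ⟶ D} {k : Y ⟶ D}

lemma IsHomotopyPullback.w (sq : IsHomotopyPullback f g h k) : f ≫ h = g ≫ k := sq.1

lemma isHomotopyPullback_iff (R : PullbackModel h k) (w : f ≫ h = g ≫ k) :
    IsHomotopyPullback f g h k ↔ WeakEquivalence (R.lift w) := by
  constructor
  · rintro ⟨_, S, hS⟩
    rw [← PullbackModel.weakEquivalence_ofFibrantReplacement_lift_iff] at hS
    rwa [R.weakEquivalence_lift_iff (.ofFibrantReplacement S)]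
  · intro hR
    refine ⟨w, R.toFibrantReplacement, ?_⟩
    rwa [← PullbackModel.weakEquivalence_ofFibrantReplacement_lift_iff,
      PullbackModel.weakEquivalence_lift_iff _ R]

lemma IsHomotopyPullback.weakEquivalence_lift (sq : IsHomotopyPullback f g h k)
    (R : PullbackModel h k) : WeakEquivalence (R.lift sq.w) :=
  (isHomotopyPullback_iff R sq.w).1 sq

lemma IsHomotopyPullback.of_isPullback (sq : IsPullback f g h k) [Fibration h] [Fibration k]
    [IsFibrant D] : IsHomotopyPullback f g h k := by
  let R : PullbackModel h k := ⟨_, _, _, _, 𝟙 _, 𝟙 _, 𝟙 _, h, k, f, g, sq, by simp, by simp⟩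
  rw [isHomotopyPullback_iff R sq.w, R.lift_eq (t := 𝟙 A) sq.w (by simp [R]) (by simp [R])]
  infer_instance

lemma IsHomotopyPullback.flip (sq : IsHomotopyPullback f g h k) :
    IsHomotopyPullback g f k h := by
  obtain ⟨R, -⟩ := PullbackModel.exists_cofibration h k
  have := sq.weakEquivalence_lift R
  let R' : PullbackModel k h :=
    ⟨_, _, _, _, R.y, R.x, R.d, _, _, _, _, R.isPullback.flip, R.comm_right, R.comm_left⟩
  rw [isHomotopyPullback_iff R' sq.w.symm,
    R'.lift_eq (t := R.lift sq.w) sq.w.symm (R.lift_snd _) (R.lift_fst _)]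
  exact this

/-- In a fibrant replacement the bottom map becomes a trivial fibration, so its strict base change
is a weak equivalence. -/
lemma IsHomotopyPullback.of_horiz_weakEquivalence [WeakEquivalence f] [WeakEquivalence k]
    (w : f ≫ h = g ≫ k) : IsHomotopyPullback f g h k := by
  obtain ⟨R, -⟩ := PullbackModel.exists_cofibration h k
  have : WeakEquivalence R.k' := by
    have : WeakEquivalence (R.y ≫ R.k') := R.comm_right ▸ inferInstance
    exact weakEquivalence_of_precomp R.y R.k'
  have : WeakEquivalence R.fst := weakEquivalence_of_isPullback_of_fibration R.isPullback.flip
  rw [isHomotopyPullback_iff R w]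
  exact weakEquivalence_of_postcomp_of_fac (R.lift_fst w)

end

/-- The pasting law: if the right square is a homotopy pull-back, then the outer square is one if
and only if the left square is. -/
lemma IsHomotopyPullback.paste_horiz_iff {X₁ X₂ X₃ Y₁ Y₂ Y₃ : C} {f₁ : X₁ ⟶ X₂} {f₂ : X₂ ⟶ X₃}
    {g₁ : Y₁ ⟶ Y₂} {g₂ : Y₂ ⟶ Y₃} {v₁ : X₁ ⟶ Y₁} {v₂ : X₂ ⟶ Y₂} {v₃ : X₃ ⟶ Y₃}
    (sq : IsHomotopyPullback f₂ v₂ v₃ g₂) (w : f₁ ≫ v₂ = v₁ ≫ g₁) :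
    IsHomotopyPullback (f₁ ≫ f₂) v₁ v₃ (g₁ ≫ g₂) ↔ IsHomotopyPullback f₁ v₁ v₂ g₁ := by
  obtain ⟨R, -⟩ := PullbackModel.exists_cofibration v₃ g₂
  have := sq.weakEquivalence_lift R
  let y := MorphismProperty.factorizationData (trivialCofibrations C) (fibrations C) (g₁ ≫ R.y)
  have : Fibration R.snd := fibration_of_isPullback R.isPullback
  have : IsFibrant R.Y' := isFibrant_of_fibration R.k'
  obtain ⟨T, a, b, hT⟩ := exists_isPullback R.snd y.p
  -- By hypothesis `X₂ ⟶ R.T` is a weak equivalence, so `R.T` may serve as the replacement of `X₂`.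
  -- Then `L` and `O` share the pull-back `T`, and their comparison maps coincide.
  let L : PullbackModel v₂ g₁ :=
    ⟨_, _, _, _, R.lift sq.w, y.i, R.y, R.snd, y.p, a, b, hT, R.lift_snd _, y.fac⟩
  let O : PullbackModel v₃ (g₁ ≫ g₂) :=
    ⟨_, _, _, _, R.x, y.i, R.d, R.h', y.p ≫ R.k', a ≫ R.fst, b, hT.paste_horiz R.isPullback,
      R.comm_left, by simp [R.comm_right]⟩
  have w' : (f₁ ≫ f₂) ≫ v₃ = v₁ ≫ g₁ ≫ g₂ := by
    rw [Category.assoc, sq.w, reassoc_of% w]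
  rw [isHomotopyPullback_iff L w, isHomotopyPullback_iff O w', O.lift_eq (t := L.lift w)]
  · have := L.lift_fst w
    rw [← Category.assoc, this, Category.assoc, R.lift_fst, Category.assoc]
  · exact L.lift_snd w

/-! ### Homotopy push-outs of cofibrant spans -/

/-- If `X ← A → Y` is a cofibrant span, the strict push-out computes the homotopy push-out. -/
lemma IsHomotopyPushout.weakEquivalence_of_isPushout {A X Y D T : C} {f : A ⟶ X} {g : A ⟶ Y}
    {h : X ⟶ D} {k : Y ⟶ D} (sq : IsHomotopyPushout f g h k) [Cofibration f] [Cofibration g]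
    [IsCofibrant A] {i₁ : X ⟶ T} {i₂ : Y ⟶ T} (hT : IsPushout f g i₁ i₂) {t : T ⟶ D}
    (h₁ : i₁ ≫ t = h) (h₂ : i₂ ≫ t = k) : WeakEquivalence t := by
  obtain ⟨w, Q, hQ⟩ := sq
  have := Q.isCofibrantSpan.cofibrant_zero
  have := Q.isCofibrantSpan.cofibration_fst
  have := Q.isCofibrantSpan.cofibration_snd
  let a : Q.diag.obj .zero ⟶ A := Q.π.app .zero
  let x : Q.diag.obj .left ⟶ X := Q.π.app .left
  let y : Q.diag.obj .right ⟶ Y := Q.π.app .right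
  let q : Q.hocolim ⟶ D := Q.desc (PushoutCocone.mk h k w).ι
  have : WeakEquivalence a := Q.weakEquivalence _
  have : WeakEquivalence x := Q.weakEquivalence _
  have : WeakEquivalence y := Q.weakEquivalence _
  have : WeakEquivalence q := hQ
  have hP := IsPushout.of_isColimit_cocone (colimit.isColimit Q.diag)
  have hf : Q.diag.map WalkingSpan.Hom.fst ≫ x = a ≫ f := Q.π.naturality WalkingSpan.Hom.fst
  have hg : Q.diag.map WalkingSpan.Hom.snd ≫ y = a ≫ g := Q.π.naturality WalkingSpan.Hom.snd
  have hq₁ : colimit.ι Q.diag .left ≫ q = x ≫ h := colimit.ι_desc _ _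
  have hq₂ : colimit.ι Q.diag .right ≫ q = y ≫ k := colimit.ι_desc _ _
  let s : Q.hocolim ⟶ T := hP.desc (x ≫ i₁) (y ≫ i₂) (by
    rw [reassoc_of% hf, reassoc_of% hg, hT.w])
  have hs₁ : colimit.ι Q.diag .left ≫ s = x ≫ i₁ := hP.inl_desc _ _ _
  have hs₂ : colimit.ι Q.diag .right ≫ s = y ≫ i₂ := hP.inr_desc _ _ _
  have : WeakEquivalence s :=
    weakEquivalence_of_isPushout_of_isPushout hP hT hf hg hs₁ hs₂
  have hd : s ≫ t = q := hP.hom_ext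
    (by rw [colimit.cocone_ι, reassoc_of% hs₁, hq₁, h₁])
    (by rw [colimit.cocone_ι, reassoc_of% hs₂, hq₂, h₂])
  exact weakEquivalence_of_precomp_of_fac hd

lemma isHomotopyPushout_of_isCofibrantSpan {Q : WalkingSpan ⥤ C} (hQ : IsCofibrantSpan Q) {T : C}
    (t : colimit Q ⟶ T) [WeakEquivalence t] :
    IsHomotopyPushout (Q.map WalkingSpan.Hom.fst) (Q.map WalkingSpan.Hom.snd)
      (colimit.ι Q .left ≫ t) (colimit.ι Q .right ≫ t) := by
  have w : Q.map WalkingSpan.Hom.fst ≫ colimit.ι Q .left ≫ t =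
      Q.map WalkingSpan.Hom.snd ≫ colimit.ι Q .right ≫ t := by
    rw [colimit.w_assoc, colimit.w_assoc]
  let R : CofibrantReplacement (span (Q.map WalkingSpan.Hom.fst) (Q.map WalkingSpan.Hom.snd)) :=
    ⟨Q, (diagramIsoSpan Q).hom, hQ, fun i => inferInstance⟩
  refine ⟨w, R, ?_⟩
  have : R.desc (PushoutCocone.mk _ _ w).ι = t := by
    refine (IsPushout.of_isColimit_cocone (colimit.isColimit Q)).hom_ext ?_ ?_
    · refine (colimit.ι_desc _ _).trans ?_
      exact Category.id_comp _
    · refine (colimit.ι_desc _ _).trans ?_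
      exact Category.id_comp _
  rw [this]
  assumption

end

/-! ### The cube over `P → B` -/

section

variable {M : Type u} [Category.{v} M] [ModelCategory M]

/-- The homotopy colimit of the homotopy pull-backs of `p` along `b` is the homotopy pull-back
along `b` of the map induced on homotopy colimits. -/
theorem CubeAxiom.isHomotopyPullback_hocolim (hcube : CubeAxiom M)
    {F E : WalkingSpan ⥤ M} {B P : M}
    (j : F ⟶ E) (p : E ⟶ (Functor.const WalkingSpan).obj B)
    (c : F ⟶ (Functor.const WalkingSpan).obj P) (b : P ⟶ B)
    (hfib : ∀ i, IsHomotopyPullback (Y := P) (D := B) (j.app i) (c.app i) (p.app i) b)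
    (QF : CofibrantReplacement F) (QE : CofibrantReplacement E)
    (j' : QF.diag ⟶ QE.diag) (hj' : j' ≫ QE.π = QF.π ≫ j) :
    IsHomotopyPullback (QF.map QE j') (QF.desc c) (QE.desc p) b := by
  have hj (i) : j'.app i ≫ QE.π.app i = QF.π.app i ≫ j.app i := congr_app hj' i
  let c' (i) : QF.diag.obj i ⟶ P := QF.π.app i ≫ c.app i
  let p' (i) : QE.diag.obj i ⟶ B := QE.π.app i ≫ p.app i
  have hc' {i i'} (φ : i ⟶ i') : QF.diag.map φ ≫ c' i' = c' i := by
    have := c.naturality φ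
    simp only [c', QF.π.naturality_assoc, this]
    simp
  have hp' {i i'} (φ : i ⟶ i') : QE.diag.map φ ≫ p' i' = p' i := by
    have := p.naturality φ
    simp only [p', QE.π.naturality_assoc, this]
    simp
  have ιc (i) : colimit.ι QF.diag i ≫ QF.desc c = c' i := colimit.ι_desc _ _
  have ιp (i) : colimit.ι QE.diag i ≫ QE.desc p = p' i := colimit.ι_desc _ _
  have ιj (i) : colimit.ι QF.diag i ≫ QF.map QE j' = j'.app i ≫ colimit.ι QE.diag i :=
    ι_colimMap _ _
  have fib (i) : IsHomotopyPullback (c' i) (j'.app i) b (p' i) := by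
    have := QF.weakEquivalence i
    have := QE.weakEquivalence i
    exact ((hfib i).flip.paste_horiz_iff (hj i).symm).2
      (.of_horiz_weakEquivalence (hj i).symm)
  have w : QF.map QE j' ≫ QE.desc p = QF.desc c ≫ b := by
    refine colimit.hom_ext fun i => ?_
    rw [reassoc_of% ιj, ιp, reassoc_of% ιc, (fib i).w]
  obtain ⟨R, -⟩ := PullbackModel.exists_cofibration (QE.desc p) b
  rw [isHomotopyPullback_iff R w]
  have total : IsHomotopyPullback R.snd R.fst R.k' R.h' :=
    (IsHomotopyPullback.of_isPullback R.isPullback).flip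
  have base : IsHomotopyPullback R.y b R.k' R.d := .of_horiz_weakEquivalence R.comm_right
  have hlift (i) : (colimit.ι QF.diag i ≫ R.lift w) ≫ R.snd = c' i ≫ R.y := by
    rw [Category.assoc, R.lift_snd, reassoc_of% ιc]
  have hlift' (i) : (colimit.ι QF.diag i ≫ R.lift w) ≫ R.fst =
      j'.app i ≫ colimit.ι QE.diag i ≫ R.x := by
    rw [Category.assoc, R.lift_fst, reassoc_of% ιj]
  -- Cancel `total`: the outer rectangle is also `fib i` pasted with the replacement square `base`.
  have side (i) : IsHomotopyPullback (colimit.ι QF.diag i ≫ R.lift w) (j'.app i)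
      R.fst (colimit.ι QE.diag i ≫ R.x) := by
    rw [← total.paste_horiz_iff (hlift' i), hlift,
      Category.assoc (colimit.ι _ _), R.comm_left, reassoc_of% ιp]
    exact (base.paste_horiz_iff (fib i).w).2 (fib i)
  -- Cancel `fib i'` from `fib i`: both are pulled back from `P → B`.
  have leg {i i'} (φ : i ⟶ i') : IsHomotopyPullback (QF.diag.map φ) (j'.app i)
      (j'.app i') (QE.diag.map φ) := by
    rw [← (fib i').paste_horiz_iff (j'.naturality φ), hc', hp']
    exact fib i
  have top := hcube _ _ _ _ (QF.diag.map WalkingSpan.Hom.fst) (QF.diag.map WalkingSpan.Hom.snd)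
    (colimit.ι QF.diag .left ≫ R.lift w) (colimit.ι QF.diag .right ≫ R.lift w) _ _ _ _
    (by rw [colimit.w_assoc, colimit.w_assoc])
    (isHomotopyPushout_of_isCofibrantSpan QE.isCofibrantSpan R.x)
    (leg _) (leg _) (side _) (side _)
  have := QF.isCofibrantSpan.cofibrant_zero
  have := QF.isCofibrantSpan.cofibration_fst
  have := QF.isCofibrantSpan.cofibration_snd
  exact top.weakEquivalence_of_isPushout
    (IsPushout.of_isColimit_cocone (colimit.isColimit QF.diag)) rfl rfl

end

end HoFiber

theorem proposition1p3 {M : Type u} [Category.{v} M] [ModelCategory M] [HasZeroObject M]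
    (hcube : HoFiber.CubeAxiom M)
    {F E : WalkingSpan ⥤ M} {B P : M}
    (j : F ⟶ E) (p : E ⟶ (Functor.const WalkingSpan).obj B)
    (c : F ⟶ (Functor.const WalkingSpan).obj P) (b : P ⟶ B)
    (hfib : ∀ i : WalkingSpan, HoFiber.IsHomotopyFiber (B := B) (P := P)
      (j.app i) (p.app i) (c.app i) b)
    (QF : HoFiber.CofibrantReplacement F) (QE : HoFiber.CofibrantReplacement E)
    (j' : QF.diag ⟶ QE.diag) (hj' : j' ≫ QE.π = QF.π ≫ j) :
    HoFiber.IsHomotopyFiber (QF.map QE j') (QE.desc p) (QF.desc c) b :=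
  ⟨(hfib .zero).1,
    hcube.isHomotopyPullback_hocolim j p c b (fun i => (hfib i).2) QF QE j' hj'⟩
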